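/- Let $\mathbb N=\{1,2,3,\dots\}$, $S=\mathbb C\setminus\mathbb N$ and $\mathbb C^*=\mathbb C\setminus\{0\}$. Let $\mathscr C=\mathscr C(S,\mathbb C^*)$ be the space of continuous maps $S\to\mathbb C^*$ with the compact-open topology, and let $\mathscr O=\mathscr O(S,\mathbb C^*)\subset\mathscr C$ be the subspace of holomorphic maps. Then: 1. Neither $\mathscr O$ nor $\mathscr C$ is semilocally contractible (a space $Y$ is semilocally contractible if every point of $Y$ has a neighbourhood whose inclusion into $Y$ is nullhomotopic). 2. Neither $\mathscr O$ nor $\mathscr C$ is m-cofibrant: neither has the homotopy type of a CW complex, and neither is a cofibrant object of the mixed model structure on topological spaces (weak equivalences: weak homotopy equivalences; fibrations: Hurewicz fibrations; cofibrations: the maps with the left lifting property against all Hurewicz fibrations that are weak homotopy equivalences). 3. The map that takes $f$ to its sequence of winding numbers about the punctures $1,2,3,\dots$ has a continuous holomorphic section: there is a continuous map $\mathbb Z^{\mathbb N}\to\mathscr O$, $\nu\mapsto f_\nu$, where $\mathbb Z^{\mathbb N}$ carries the product topology of the discrete topologies, such that for every $\nu$ and every $n\in\mathbb N$ the winding number of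 $f_\nu$ about $n$ (that is, along the positively oriented circle of radius $1/2$ centred at $n$) is $\nu(n)$. 4. $\mathscr O$ is a deformation retract of $\mathscr C$, in the strong sense: there is a continuous map $H:\mathscr C\times[0,1]\to\mathscr C$ such that $H(f,0)=f$ and $H(f,1)\in\mathscr O$ for all $f\in\mathscr C$, and $H(f,t)=f$ for all $f\in\mathscr O$ and $t\in[0,1]$. -/

import Mathlib

open scoped unitInterval Topology

/-! ### Homotopy theory of topological spaces -/

/-- `A` is a deformation retract of `X`, in the sense of Hatcher and May (classically, a *strong*
deformation retract): there is a retraction `r : X → A` whose composition with the inclusion is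
homotopic to the identity of `X` by a homotopy that is stationary on `A`. -/
def IsDeformationRetract {X : Type*} [TopologicalSpace X] (A : Set X) : Prop :=
  ∃ r : C(X, A),
    (ContinuousMap.id X).HomotopicRel ((⟨Subtype.val, continuous_subtype_val⟩ : C(A, X)).comp r) A

/-- `X` is semilocally contractible: every point has a neighbourhood that is contractible in `X`,
i.e. whose inclusion into `X` is nullhomotopic. -/
def SemilocallyContractible (X : Type*) [TopologicalSpace X] : Prop :=
  ∀ x : X, ∃ U ∈ 𝓝 x, (⟨Subtype.val, continuous_subtype_val⟩ : C(U, X)).Nullhomotopic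

/-- `X` has the homotopy type of a CW complex. -/
def HasCWHomotopyType.{u} (X : Type u) [TopologicalSpace X] : Prop :=
  ∃ (Y : Type u) (_ : TopologicalSpace Y) (_ : T2Space Y),
    Nonempty (Topology.CWComplex (Set.univ : Set Y)) ∧ Nonempty (ContinuousMap.HomotopyEquiv X Y)

/-- The map of sets of path components induced by a continuous map. -/
def zerothHomotopyMap {X Y : Type*} [TopologicalSpace X] [TopologicalSpace Y] (f : C(X, Y)) :
    ZerothHomotopy X → ZerothHomotopy Y :=
  Quotient.map f fun _ _ h => h.map f.continuous

/-- The map `π_n(X, x) → π_n(Y, f x)` induced by a continuous map `f : X → Y`. -/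
def homotopyGroupMap {X Y : Type*} [TopologicalSpace X] [TopologicalSpace Y] (f : C(X, Y))
    (n : ℕ) (x : X) : HomotopyGroup.Pi n X x → HomotopyGroup.Pi n Y (f x) :=
  Quotient.map
    (fun p => (⟨f.comp p.1, fun y hy => congrArg f (p.2 y hy)⟩ : GenLoop (Fin n) Y (f x)))
    fun _ _ h => h.map fun H => H.compContinuousMap f

/-- Weak homotopy equivalences: continuous maps that induce bijections of the sets of path
components and of all homotopy groups at all base points. -/
def IsWeakHomotopyEquiv {X Y : Type*} [TopologicalSpace X] [TopologicalSpace Y]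
    (f : C(X, Y)) : Prop :=
  Function.Bijective (zerothHomotopyMap f) ∧
    ∀ (n : ℕ) (x : X), 1 ≤ n → Function.Bijective (homotopyGroupMap f n x)

/-- Hurewicz fibrations: maps with the homotopy lifting property for all spaces. -/
def IsHurewiczFibration.{u} {E B : Type u} [TopologicalSpace E] [TopologicalSpace B]
    (p : C(E, B)) : Prop :=
  ∀ (A : Type u) [TopologicalSpace A] (h₀ : C(A, E)) (H : C(A × I, B)),
    (∀ a, H (a, 0) = p (h₀ a)) →
    ∃ L : C(A × I, E), (∀ a, L (a, 0) = h₀ a) ∧ ∀ y, p (L y) = H y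

/-- Cofibrations of the mixed model structure on topological spaces, whose weak equivalences are
the weak homotopy equivalences and whose fibrations are the Hurewicz fibrations: the maps with the
left lifting property against all maps that are both. -/
def IsMCofibration.{u} {A X : Type u} [TopologicalSpace A] [TopologicalSpace X]
    (i : C(A, X)) : Prop :=
  ∀ (E B : Type u) [TopologicalSpace E] [TopologicalSpace B] (p : C(E, B)),
    IsHurewiczFibration p → IsWeakHomotopyEquiv p →
    ∀ (u : C(A, E)) (v : C(X, B)), p.comp u = v.comp i →
      ∃ l : C(X, E), l.comp i = u ∧ p.comp l = v

/-- `X` is cofibrant in the mixed model structure: `∅ → X` is a cofibration there. -/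
def IsMCofibrant.{u} (X : Type u) [TopologicalSpace X] : Prop :=
  IsMCofibration (⟨PEmpty.elim, continuous_of_discreteTopology⟩ : C(PEmpty.{u + 1}, X))

/-! ### The mapping spaces -/

/-- The plane punctured at the positive integers. -/
def PuncturedPlane : Set ℂ := {z | ∀ n : ℕ+, z ≠ (n : ℂ)}

/-- The punctured plane `ℂ*`. -/
def CStar : Set ℂ := {z | z ≠ 0}

/-- The space of continuous maps `ℂ ∖ ℕ → ℂ*`, with the compact-open topology. -/
abbrev ContMaps : Type := C(PuncturedPlane, CStar)

/-- The holomorphic maps `ℂ ∖ ℕ → ℂ*`, as a subspace of the space of continuous maps. -/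
def HolMaps : Set ContMaps :=
  {f | ∃ F : ℂ → ℂ, DifferentiableOn ℂ F PuncturedPlane ∧ ∀ z : PuncturedPlane, F z = f z}

/-- The domain is open in `ℂ`, so that `DifferentiableOn ℂ` on it means holomorphic. -/
theorem isOpen_puncturedPlane : IsOpen PuncturedPlane := by
  have h : PuncturedPlane = (((↑) : ℤ → ℂ) '' {m | 0 < m})ᶜ := by
    ext z
    simp only [PuncturedPlane, Set.mem_ofPred_eq, Set.mem_compl_iff, Set.mem_image, not_exists,
      not_and]
    constructor
    · intro hz m hm hmz
      refine hz ⟨m.toNat, by omega⟩ ?_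
      rw [← hmz]
      have : ((m.toNat : ℤ) : ℂ) = (m : ℂ) := by rw [Int.toNat_of_nonneg hm.le]
      rw [← this]; rfl
    · intro hz n hn
      exact hz (n : ℕ) (by exact_mod_cast n.pos) (by rw [hn]; simp)
  rw [h]
  exact (Complex.isClosedEmbedding_intCast.isClosedMap _ (isClosed_discrete _)).isOpen_compl

theorem circle_mem_puncturedPlane (n : ℕ+) (t : I) :
    (n : ℂ) + (1 / 2 : ℂ) * Complex.exp (2 * Real.pi * Complex.I * (t : ℝ)) ∈ PuncturedPlane := by
  intro m h
  have h1 : (1 / 2 : ℂ) * Complex.exp (2 * Real.pi * Complex.I * (t : ℝ))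
      = (((m : ℤ) - (n : ℤ) : ℤ) : ℂ) := by
    push_cast
    linear_combination h
  have h2 : ‖(1 / 2 : ℂ) * Complex.exp (2 * Real.pi * Complex.I * (t : ℝ))‖ = 1 / 2 := by
    rw [norm_mul, Complex.norm_exp]
    simp
  rw [h1, Complex.norm_intCast] at h2
  have h3 : (2 * |(m : ℤ) - (n : ℤ)| : ℤ) = 1 := by
    have : (2 * |(((m : ℤ) - (n : ℤ) : ℤ) : ℝ)|) = 1 := by rw [h2]; norm_num
    exact_mod_cast this
  omega

/-- The positively oriented circle `t ↦ n + e^{2πit} / 2` about the puncture `n`, for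
`0 ≤ t ≤ 1`; it contains no other puncture in its interior. -/
noncomputable def punctureLoop (n : ℕ+) : C(I, PuncturedPlane) where
  toFun t := ⟨_, circle_mem_puncturedPlane n t⟩
  continuous_toFun := by fun_prop

/-- `f` has winding number `k` about the puncture `n`: a continuous logarithm of `f` along the
positively oriented circle about `n` increases by `2πik`. -/
def HasWindingNumber (f : ContMaps) (n : ℕ+) (k : ℤ) : Prop :=
  ∃ g : C(I, ℂ), (∀ t, Complex.exp (g t) = f (punctureLoop n t)) ∧
    g 1 - g 0 = 2 * Real.pi * Complex.I * k

/-! All six negative statements follow from one invariant: semilocal contractibility, the homotopy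
type of a CW complex and m-cofibrancy each force path components to be open. For m-cofibrancy,
`PathSplit X → X`, where `X` is refined so that its path components become open, is a Hurewicz
fibration and a weak equivalence; a cofibrant `X` therefore has a continuous section of it. Winding
numbers are continuous and integer-valued, hence constant on path components. A continuous section
`ν ↦ f_ν` then rules out open path components (`not_openPathComponents`): the unit sequences `e_n`
tend to `0` in the product topology, so the maps with divisor `e_n` tend to the map with divisor
`0`, but none is joined to it.

The section is a Weierstrass product. Its convergence factors depend on the multiplicities `ν n` in
such a way that the tail estimate is uniform in `ν` (`exists_convergence_factor`), which makes the
product jointly continuous in `ν` and `z`.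

For the deformation, divide `f` by the Weierstrass product with the same winding numbers. The
quotient has winding numbers zero, so up to its value at `0` it is `exp (L f)` with `L f` continuous
in `f` (`exists_log_of_winding_eq_zero`). Holomorphic functions form a closed convex subset of `C(S,
ℂ)`, onto which there is a retraction `r` by a Dugundji-type argument. The homotopy is `f * exp (t *
(r (L f) - L f))`; it is stationary on holomorphic `f`, because then `L f` is holomorphic.

To obtain logarithms continuous in `f`, the plane is cut along downward or upward vertical rays from
the punctures. Both cut domains are contractible, and the two logarithms differ by a constant on
each vertical strip between punctures. Winding numbers are the differences of consecutive constants,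
divided by `2πi`. -/

/-! ### Spaces with open path components -/

/-- The path components of `X` are open. -/
def OpenPathComponents (X : Type*) [TopologicalSpace X] : Prop :=
  ∀ x : X, pathComponent x ∈ 𝓝 x

/-- A nullhomotopy of the inclusion of `U` traces paths in `X` from all points of `U` to one common
point. -/
theorem SemilocallyContractible.openPathComponents {X : Type*} [TopologicalSpace X]
    (h : SemilocallyContractible X) : OpenPathComponents X := by
  intro x
  obtain ⟨U, hU, y, ⟨H⟩⟩ := h x
  have key : ∀ u : U, Joined (u : X) y := fun u =>
    ⟨{ toFun := fun t => H (t, u)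
       continuous_toFun := by fun_prop
       source' := by simp
       target' := by simp }⟩
  exact Filter.mem_of_superset hU fun u hu =>
    (key ⟨x, mem_of_mem_nhds hU⟩).trans (key ⟨u, hu⟩).symm

theorem ContinuousMap.Homotopic.joined {X Y : Type*} [TopologicalSpace X] [TopologicalSpace Y]
    {f g : C(X, Y)} (h : f.Homotopic g) (x : X) : Joined (f x) (g x) := by
  obtain ⟨H⟩ := h
  exact ⟨{ toFun := fun t => H (t, x)
           continuous_toFun := by fun_prop
           source' := by simp
           target' := by simp }⟩

theorem OpenPathComponents.of_homotopyEquiv {X Y : Type*} [TopologicalSpace X]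
    [TopologicalSpace Y] (h : OpenPathComponents Y) (e : ContinuousMap.HomotopyEquiv X Y) :
    OpenPathComponents X := by
  obtain ⟨f, g, hgf, -⟩ := e
  intro x
  have hx : f ⁻¹' pathComponent (f x) ∈ 𝓝 x :=
    f.continuous.continuousAt.preimage_mem_nhds (h (f x))
  have key : ∀ y, Joined (f x) (f y) → Joined x y := fun y hy => by
    have h₁ : Joined (g (f x)) x := hgf.joined x
    have h₂ : Joined (g (f y)) y := hgf.joined y
    exact (h₁.symm.trans (hy.map g.continuous)).trans h₂
  exact Filter.mem_of_superset hx key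

/-- Closedness is tested on closed cells. These are path connected, so the complement of a path
component contains each of them or misses it. -/
theorem Topology.CWComplex.openPathComponents {Y : Type*} [TopologicalSpace Y] [T2Space Y]
    [Topology.CWComplex (Set.univ : Set Y)] : OpenPathComponents Y := by
  intro x
  have hcell : ∀ (n : ℕ) (j : Topology.RelCWComplex.cell (Set.univ : Set Y) n),
      IsPathConnected (Topology.RelCWComplex.closedCell (C := Set.univ) n j) := by
    intro n j
    have hball : IsPathConnected (Metric.closedBall (0 : Fin n → ℝ) 1) :=
      (convex_closedBall _ _).isPathConnected ⟨0, Metric.mem_closedBall_self zero_le_one⟩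
    exact hball.image' (Topology.RelCWComplex.continuousOn n j)
  have hclosed : IsClosed (pathComponent x)ᶜ := by
    rw [Topology.CWComplex.closed (Set.univ : Set Y) _ (Set.subset_univ _)]
    intro n j
    by_cases hj : ∃ y ∈ Topology.RelCWComplex.closedCell (C := Set.univ) n j, Joined x y
    · obtain ⟨y, hy, hxy⟩ := hj
      convert isClosed_empty
      rw [Set.eq_empty_iff_forall_notMem]
      rintro z ⟨hz, hz'⟩
      exact hz (hxy.trans ((hcell n j).joinedIn y hy z hz').joined)
    · have : (pathComponent x)ᶜ ∩ Topology.RelCWComplex.closedCell (C := Set.univ) n j =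
          Topology.RelCWComplex.closedCell (C := Set.univ) n j :=
        Set.inter_eq_right.2 fun z hz hxz => hj ⟨z, hz, hxz⟩
      rw [this]
      exact Topology.RelCWComplex.isClosed_closedCell
  exact (isClosed_compl_iff.1 hclosed).mem_nhds (mem_pathComponent_self x)

theorem HasCWHomotopyType.openPathComponents {X : Type*} [TopologicalSpace X]
    (h : HasCWHomotopyType X) : OpenPathComponents X := by
  obtain ⟨Y, _, _, ⟨_⟩, ⟨e⟩⟩ := h
  exact Topology.CWComplex.openPathComponents.of_homotopyEquiv e

/-! ### Refining a topology so that path components become open -/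

instance unitInterval.pathConnectedSpace : PathConnectedSpace I :=
  isPathConnected_iff_pathConnectedSpace.1
    ((convex_Icc (0 : ℝ) 1).isPathConnected ⟨0, by simp⟩)

/-- `X` with the coarsest finer topology for which the path components are open. -/
def PathSplit (X : Type*) : Type _ := X

namespace PathSplit

variable {X : Type*} [TopologicalSpace X]

instance : TopologicalSpace (PathSplit X) :=
  ‹TopologicalSpace X› ⊓ TopologicalSpace.induced (ZerothHomotopy.mk : X → ZerothHomotopy X) ⊥

variable (X) in
/-- The identity map to the original space. -/
def proj : C(PathSplit X, X) := ⟨fun x => x, continuous_id_iff_le.2 inf_le_left⟩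

theorem eventually_joined (x : PathSplit X) : ∀ᶠ y in 𝓝 x, Joined (proj X x) (proj X y) := by
  have hc : @Continuous _ _ _ ⊥ fun x : PathSplit X => ZerothHomotopy.mk (proj X x) :=
    continuous_iff_le_induced.2 inf_le_right
  let _ : TopologicalSpace (ZerothHomotopy X) := ⊥
  have : DiscreteTopology (ZerothHomotopy X) := ⟨rfl⟩
  have hx := hc.continuousAt (x := x)
  rw [ContinuousAt, nhds_discrete (ZerothHomotopy X), Filter.tendsto_pure] at hx
  filter_upwards [hx] with y hy
  exact (Quotient.exact hy).symm

/-- A continuous map that stays locally in one path component lifts to `PathSplit`. -/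
def lift {T : Type*} [TopologicalSpace T] (F : C(T, X))
    (hF : ∀ t, ∀ᶠ t' in 𝓝 t, Joined (F t) (F t')) : C(T, PathSplit X) where
  toFun t := F t
  continuous_toFun := by
    let _ : TopologicalSpace (ZerothHomotopy X) := ⊥
    have : DiscreteTopology (ZerothHomotopy X) := ⟨rfl⟩
    refine continuous_inf_rng.2 ⟨F.continuous, continuous_induced_rng.2 ?_⟩
    refine continuous_iff_continuousAt.2 fun t => ?_
    rw [ContinuousAt, nhds_discrete (ZerothHomotopy X), Filter.tendsto_pure]
    filter_upwards [hF t] with t' ht'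
    exact (Quotient.sound ht').symm

theorem exists_lift {T : Type*} [TopologicalSpace T] [PathConnectedSpace T] (F : C(T, X)) :
    ∃ L : C(T, PathSplit X), ∀ t, proj X (L t) = F t :=
  ⟨lift F fun t => .of_forall fun t' => (PathConnectedSpace.joined t t').map F.continuous,
    fun _ => rfl⟩

theorem proj_injective : Function.Injective (proj X) := fun _ _ h => h

/-- Paths, cubes and homotopies of cubes have path connected domains, so they lift uniquely through
`proj`. -/
theorem isWeakHomotopyEquiv_proj : IsWeakHomotopyEquiv (proj X) := by
  refine ⟨⟨?_, ?_⟩, fun n x _ => ⟨?_, ?_⟩⟩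
  · rintro ⟨x⟩ ⟨y⟩ h
    obtain ⟨γ⟩ : Joined (proj X x) (proj X y) := Quotient.exact h
    obtain ⟨L, hL⟩ := exists_lift γ.toContinuousMap
    refine Quotient.sound ⟨⟨L, proj_injective ?_, proj_injective ?_⟩⟩
    · exact (hL 0).trans γ.source
    · exact (hL 1).trans γ.target
  · rintro ⟨x⟩
    exact ⟨ZerothHomotopy.mk (show PathSplit X from x), rfl⟩
  · rintro ⟨p⟩ ⟨q⟩ h
    obtain ⟨H⟩ : GenLoop.Homotopic _ _ := Quotient.exact h
    obtain ⟨L, hL⟩ := exists_lift H.toContinuousMap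
    refine Quotient.sound ⟨⟨⟨L, fun y => proj_injective ?_, fun y => proj_injective ?_⟩, ?_⟩⟩
    · exact (hL (0, y)).trans (H.apply_zero y)
    · exact (hL (1, y)).trans (H.apply_one y)
    · intro t y hy
      exact proj_injective ((hL (t, y)).trans (H.eq_fst t hy))
  · rintro ⟨p⟩
    obtain ⟨L, hL⟩ := exists_lift p.1
    refine ⟨Quotient.mk _ ⟨L, fun y hy => proj_injective ((hL y).trans (p.2 y hy))⟩, ?_⟩
    refine congrArg (Quotient.mk _) ?_
    ext y
    exact hL y

/-- The lift is `H` itself. It stays locally in one path component: `H (a, t)` is joined to `h₀ a`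
along the track of `a`, and `h₀` is continuous into the finer topology. -/
theorem isHurewiczFibration_proj : IsHurewiczFibration (proj X) := by
  intro A _ h₀ H hH
  have hj : ∀ a t, Joined (H (a, t)) (proj X (h₀ a)) := by
    intro a t
    rw [← hH a]
    have := (PathConnectedSpace.joined t (0 : I)).map
      (f := fun s => H (a, s)) (by fun_prop)
    exact this
  refine ⟨lift H ?_, fun a => proj_injective (hH a), fun _ => rfl⟩
  rintro ⟨a, t⟩
  have := (h₀.continuous.comp continuous_fst).continuousAt (x := (a, t)) |>.eventually
    (eventually_joined (h₀ a))
  filter_upwards [this] with ⟨a', t'⟩ h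
  exact ((hj a t).trans h).trans (hj a' t').symm

end PathSplit

theorem IsMCofibrant.openPathComponents {X : Type*} [TopologicalSpace X]
    (h : IsMCofibrant X) : OpenPathComponents X := by
  obtain ⟨l, -, hl⟩ := h (PathSplit X) X (PathSplit.proj X) PathSplit.isHurewiczFibration_proj
    PathSplit.isWeakHomotopyEquiv_proj ⟨PEmpty.elim, continuous_of_discreteTopology⟩ (.id X)
    (by ext x; exact x.elim)
  have hl' : ∀ x, PathSplit.proj X (l x) = x := fun x => congrArg (fun f : C(X, X) => f x) hl
  intro x
  filter_upwards [l.continuous.continuousAt.eventually (PathSplit.eventually_joined (l x))]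
    with y hy
  rwa [hl', hl'] at hy

/-! ### Retractions onto closed convex sets -/

/-- A closed convex set in a real topological vector space whose topology comes from a metric with
convex balls is a retract. -/
theorem exists_retraction_of_convex_closedBall {E : Type*} [PseudoMetricSpace E] [AddCommGroup E]
    [Module ℝ E] [ContinuousAdd E] [ContinuousSMul ℝ E]
    (hball : ∀ (x : E) (ε : ℝ), Convex ℝ (Metric.closedBall x ε)) {A : Set E} (hA : IsClosed A)
    (hconv : Convex ℝ A) (hne : A.Nonempty) :
    ∃ r : C(E, E), (∀ x, r x ∈ A) ∧ ∀ x ∈ A, r x = x := by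
  -- Off `A`, choose continuously a point of `A` at most twice as far away as `A` is. The factor 2
  -- leaves room for locally constant choices, and convexity lets a partition of unity glue them.
  obtain ⟨g, hg⟩ := exists_continuous_forall_mem_convex_of_local_const
    (X := (Aᶜ : Set E)) (t := fun x : (Aᶜ : Set E) => A ∩ Metric.closedBall (x : E) (2 * Metric.infDist (x : E) A))
    (fun x => hconv.inter (hball _ _)) (by
      rintro ⟨x, hx⟩
      have hpos : 0 < Metric.infDist x A := (hA.notMem_iff_infDist_pos hne).1 hx
      obtain ⟨c, hc, hxc⟩ := (Metric.infDist_lt_iff hne).1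
        (show Metric.infDist x A < 2 * Metric.infDist x A by linarith)
      have hcont : Continuous fun y : (Aᶜ : Set E) => 2 * Metric.infDist (y : E) A :=
        continuous_const.mul ((Metric.continuous_infDist_pt A).comp continuous_subtype_val)
      have hcont' : Continuous fun y : (Aᶜ : Set E) => dist (y : E) c := by fun_prop
      refine ⟨c, ?_⟩
      filter_upwards [hcont'.continuousAt.eventually_lt hcont.continuousAt
        (show dist ((⟨x, hx⟩ : (Aᶜ : Set E)) : E) c < _ from hxc)] with y hy
      exact ⟨hc, by rw [Metric.mem_closedBall, dist_comm]; exact hy.le⟩)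
  classical
  let r : E → E := fun x => if h : x ∈ A then x else g ⟨x, h⟩
  have hrA : ∀ x ∈ A, r x = x := fun x hx => dif_pos hx
  have hrAc : ∀ x (hx : x ∉ A), r x = g ⟨x, hx⟩ := fun x hx => dif_neg hx
  have hdist : ∀ x, dist (r x) x ≤ 2 * Metric.infDist x A := by
    intro x
    by_cases hx : x ∈ A
    · rw [hrA x hx, dist_self]
      exact mul_nonneg zero_le_two Metric.infDist_nonneg
    · rw [hrAc x hx]
      exact (hg ⟨x, hx⟩).2
  refine ⟨⟨r, continuous_iff_continuousAt.2 fun x => ?_⟩, fun x => ?_, hrA⟩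
  · by_cases hx : x ∈ A
    · rw [ContinuousAt, hrA x hx, tendsto_iff_dist_tendsto_zero]
      have h3 : Filter.Tendsto (fun y => 3 * dist y x) (𝓝 x) (𝓝 0) := by
        have : Continuous fun y => 3 * dist y x := by fun_prop
        simpa using this.tendsto x
      refine squeeze_zero (fun _ => dist_nonneg) (fun y => ?_) h3
      have h1 := dist_triangle (r y) y x
      have h2 := hdist y
      have h3 : Metric.infDist y A ≤ dist y x := Metric.infDist_le_dist_of_mem hx
      linarith
    · have hopen : IsOpen (Aᶜ : Set E) := hA.isOpen_compl
      refine ContinuousOn.continuousAt (s := (Aᶜ : Set E)) ?_ (hopen.mem_nhds hx)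
      rw [continuousOn_iff_continuous_domRestrict]
      convert g.continuous using 1
      ext ⟨y, hy⟩
      exact hrAc y hy
  · by_cases hx : x ∈ A
    · exact Set.mem_of_eq_of_mem (hrA x hx) hx
    · exact Set.mem_of_eq_of_mem (hrAc x hx) (hg ⟨x, hx⟩).1

/-! ### A metric for compact convergence with convex balls -/

namespace CompactExhaustion

variable {X E : Type*} [TopologicalSpace X] [NormedAddCommGroup E] (K : CompactExhaustion X)

/-- A metric for the topology of compact convergence, for which balls are convex. -/
noncomputable def supDist (f g : C(X, E)) : ℝ :=
  sInf {ε | 0 ≤ ε ∧ ∀ n, (1 / 2 : ℝ) ^ n ≤ ε ∨ ∀ x ∈ K n, dist (f x) (g x) ≤ ε}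

/-- The infimum is attained, so a closed ball is cut out by the conditions `dist (f x) (g x) ≤ ε` on
those `K n` with `ε < (1 / 2) ^ n`. Each such condition is convex. -/
theorem supDist_le_iff {f g : C(X, E)} {ε : ℝ} (hε : 0 ≤ ε) :
    K.supDist f g ≤ ε ↔ ∀ n, (1 / 2 : ℝ) ^ n ≤ ε ∨ ∀ x ∈ K n, dist (f x) (g x) ≤ ε := by
  constructor
  · intro h n
    by_contra! hn
    obtain ⟨hn, x, hx, hxε⟩ := hn
    obtain ⟨δ, ⟨hδ0, hδ⟩, hδ'⟩ := exists_lt_of_csInf_lt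
      (s := {ε | 0 ≤ ε ∧ ∀ n, (1 / 2 : ℝ) ^ n ≤ ε ∨ ∀ x ∈ K n, dist (f x) (g x) ≤ ε})
      ⟨1, zero_le_one, fun n => .inl (pow_le_one₀ (by norm_num) (by norm_num))⟩
      (lt_of_le_of_lt h (lt_min hn hxε))
    rcases hδ n with h1 | h1
    · exact absurd (h1.trans_lt hδ') (not_lt.2 (min_le_left _ _))
    · exact absurd ((h1 x hx).trans_lt hδ') (not_lt.2 (min_le_right _ _))
  · exact fun h => csInf_le ⟨0, fun _ h => h.1⟩ ⟨hε, h⟩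

theorem supDist_nonneg (f g : C(X, E)) : 0 ≤ K.supDist f g :=
  Real.sInf_nonneg fun _ h => h.1

theorem supDist_triangle (f g h : C(X, E)) :
    K.supDist f h ≤ K.supDist f g + K.supDist g h := by
  have h1 := K.supDist_nonneg f g
  have h2 := K.supDist_nonneg g h
  rw [K.supDist_le_iff (add_nonneg h1 h2)]
  intro n
  rcases (K.supDist_le_iff h1).1 le_rfl n with h3 | h3
  · exact .inl (by linarith)
  rcases (K.supDist_le_iff h2).1 le_rfl n with h4 | h4
  · exact .inl (by linarith)
  · exact .inr fun x hx => (dist_triangle _ (g x) _).trans (add_le_add (h3 x hx) (h4 x hx))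

theorem mem_nhds_iff_supDist (f : C(X, E)) (s : Set C(X, E)) :
    s ∈ 𝓝 f ↔ ∃ ε > 0, ∀ g, K.supDist f g < ε → g ∈ s := by
  have hb := nhds_basis_uniformity'
    (K.hasBasis_compactConvergenceUniformity (Metric.uniformity_basis_dist (α := E))) (x := f)
  rw [hb.mem_iff]
  constructor
  · rintro ⟨⟨n, ε⟩, hε, hs⟩
    refine ⟨min ε ((1 / 2) ^ n), lt_min hε (by positivity), fun g hg => hs fun x hx => ?_⟩
    rcases (K.supDist_le_iff (K.supDist_nonneg f g)).1 le_rfl n with h | h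
    · exact absurd (h.trans_lt hg) (not_lt.2 (min_le_right _ _))
    · exact ((h x hx).trans_lt hg).trans_le (min_le_left _ _)
  · rintro ⟨ε, hε, hs⟩
    obtain ⟨N, hN⟩ := exists_pow_lt_of_lt_one (half_pos hε) (by norm_num : (1 / 2 : ℝ) < 1)
    refine ⟨⟨N, ε / 2⟩, half_pos hε, fun g hg => hs g ?_⟩
    refine lt_of_le_of_lt ((K.supDist_le_iff (half_pos hε).le).2 fun n => ?_) (half_lt_self hε)
    rcases le_total n N with h | h
    · exact .inr fun x hx => le_of_lt (hg x (K.subset h hx))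
    · exact .inl ((pow_le_pow_of_le_one (by norm_num) (by norm_num) h).trans hN.le)

end CompactExhaustion

/-- A closed convex set of continuous maps from a `σ`-compact locally compact space to a normed
space is a retract of the space of all such maps. -/
theorem ContinuousMap.exists_retraction_of_isClosed_convex {X E : Type*} [TopologicalSpace X]
    [WeaklyLocallyCompactSpace X] [SigmaCompactSpace X] [NormedAddCommGroup E] [NormedSpace ℝ E]
    {A : Set C(X, E)} (hA : IsClosed A) (hconv : Convex ℝ A) (hne : A.Nonempty) :
    ∃ r : C(C(X, E), C(X, E)), (∀ x, r x ∈ A) ∧ ∀ x ∈ A, r x = x := by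
  let K := CompactExhaustion.choice X
  let m : PseudoMetricSpace C(X, E) := PseudoMetricSpace.ofDistTopology K.supDist
    (fun f => le_antisymm ((K.supDist_le_iff le_rfl).2 fun n => .inr (by simp))
      (K.supDist_nonneg f f))
    (fun f g => by simp only [CompactExhaustion.supDist, dist_comm])
    K.supDist_triangle
    (fun s => isOpen_iff_mem_nhds.trans
      (forall₂_congr fun f _ => K.mem_nhds_iff_supDist f s))
  refine @exists_retraction_of_convex_closedBall C(X, E) m _ _ (inferInstanceAs (ContinuousAdd C(X, E)))
    (inferInstanceAs (ContinuousSMul ℝ C(X, E))) ?_ A hA hconv hne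
  intro f ε g hg h hh a b ha hb hab
  have hε : 0 ≤ ε := (K.supDist_nonneg g f).trans hg
  refine (K.supDist_le_iff hε).2 fun n => ?_
  rcases (K.supDist_le_iff hε).1 hg n with h1 | h1
  · exact .inl h1
  rcases (K.supDist_le_iff hε).1 hh n with h2 | h2
  · exact .inl h2
  refine .inr fun x hx => ?_
  exact convex_closedBall (f x) ε (h1 x hx) (h2 x hx) ha hb hab

/-! ### Continuous logarithms -/

/-- Homotopy lifting along `exp` holds for every space `Y`. Taking for `Y` a product with a mapping
space yields logarithms that are continuous in the map as well. -/
theorem exists_log_of_homotopy {Y : Type*} [TopologicalSpace Y] {F : I × Y → ℂ}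
    (hF : Continuous F) (hF0 : ∀ p, F p ≠ 0) {g₀ : Y → ℂ} (hg₀ : Continuous g₀)
    (h : ∀ y, Complex.exp (g₀ y) = F (0, y)) :
    ∃ g : Y → ℂ, Continuous g ∧ ∀ y, Complex.exp (g y) = F (1, y) := by
  let H : C(I × Y, {z : ℂ // z ≠ 0}) := ⟨fun p => ⟨F p, hF0 p⟩, hF.subtype_mk _⟩
  let L := Complex.isCoveringMap_exp.liftHomotopy H ⟨g₀, hg₀⟩
    fun y => Subtype.ext (h y).symm
  refine ⟨fun y => L (1, y), by fun_prop, fun y => ?_⟩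
  exact congrArg Subtype.val (congrFun (Complex.isCoveringMap_exp.liftHomotopy_lifts H ⟨g₀, hg₀⟩
    fun y => Subtype.ext (h y).symm) (1, y))

theorem eq_of_exp_eq {Y : Type*} [TopologicalSpace Y] [PreconnectedSpace Y] {g h : Y → ℂ}
    (hg : Continuous g) (hh : Continuous h) (he : ∀ y, Complex.exp (g y) = Complex.exp (h y))
    (a : Y) (ha : g a = h a) : g = h :=
  Complex.isCoveringMap_exp.eq_of_comp_eq hg hh (funext fun y => Subtype.ext (he y)) a ha

/-! ### The plane with slits -/

instance : LocallyCompactSpace PuncturedPlane := isOpen_puncturedPlane.locallyCompactSpace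

theorem mem_puncturedPlane_of_im {z : ℂ} (h : ∀ n : ℕ+, z.re = n → z.im ≠ 0) :
    z ∈ PuncturedPlane := by
  rintro n rfl
  exact h n (by simp) (by simp)

/-- The plane without the vertical rays from the positive integers to `-s · i∞`. -/
def slitDomain (s : ℝˣ) : Set ℂ := {z | ∀ n : ℕ+, z.re = n → 0 < (s : ℝ) * z.im}

theorem slitDomain_subset (s : ℝˣ) : slitDomain s ⊆ PuncturedPlane := fun z hz =>
  mem_puncturedPlane_of_im fun n hn h0 => by simpa [h0] using hz n hn

theorem isClosed_range_pnat_cast : IsClosed (Set.range fun n : ℕ+ => ((n : ℕ) : ℝ)) := by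
  have h : (Set.range fun n : ℕ+ => ((n : ℕ) : ℝ)) = ((↑) : ℤ → ℝ) '' {m | 0 < m} := by
    ext x
    constructor
    · rintro ⟨n, rfl⟩
      exact ⟨(n : ℕ), by simp, by simp⟩
    · rintro ⟨m, hm, rfl⟩
      refine ⟨⟨m.toNat, by simpa using hm⟩, ?_⟩
      exact (Int.cast_natCast m.toNat).symm.trans
        (congrArg (Int.cast : ℤ → ℝ) (Int.toNat_of_nonneg (le_of_lt hm)))
  rw [h]
  exact Int.isClosedEmbedding_coe_real.isClosedMap _ (isClosed_discrete _)

theorem isOpen_slitDomain (s : ℝˣ) : IsOpen (slitDomain s) := by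
  have h : slitDomain s = (Complex.re ⁻¹' (Set.range fun n : ℕ+ => ((n : ℕ) : ℝ))ᶜ) ∪
      {z | 0 < (s : ℝ) * z.im} := by
    ext z
    simp only [slitDomain, Set.mem_ofPred_eq, Set.mem_union, Set.mem_preimage, Set.mem_compl_iff,
      Set.mem_range, not_exists]
    constructor
    · intro hz
      by_cases h : ∃ n : ℕ+, ((n : ℕ) : ℝ) = z.re
      · obtain ⟨n, hn⟩ := h
        exact .inr (hz n hn.symm)
      · exact .inl (not_exists.1 h)
    · rintro (hz | hz) n hn
      · exact absurd hn.symm (hz n)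
      · exact hz
  rw [h]
  refine (isClosed_range_pnat_cast.isOpen_compl.preimage Complex.continuous_re).union ?_
  exact isOpen_lt continuous_const (by fun_prop)

theorem mem_slitDomain_of_re_nonpos {s : ℝˣ} {z : ℂ} (h : z.re ≤ 0) : z ∈ slitDomain s := by
  intro n hn
  have : (0 : ℝ) < n := by exact_mod_cast n.pos
  linarith

instance (s : ℝˣ) : Zero (slitDomain s) := ⟨⟨0, mem_slitDomain_of_re_nonpos le_rfl⟩⟩

instance : Zero PuncturedPlane := ⟨⟨0, slitDomain_subset 1 (0 : slitDomain 1).2⟩⟩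

@[simp] theorem coe_zero_slitDomain (s : ℝˣ) : ((0 : slitDomain s) : ℂ) = 0 := rfl

/-- The inclusion of a slit domain in the punctured plane. -/
def slitIncl (s : ℝˣ) : C(slitDomain s, PuncturedPlane) :=
  ⟨Set.inclusion (slitDomain_subset s), continuous_inclusion _⟩

@[simp] theorem coe_slitIncl (s : ℝˣ) (z : slitDomain s) : (slitIncl s z : ℂ) = z := rfl

@[simp] theorem slitIncl_zero (s : ℝˣ) : slitIncl s 0 = 0 := rfl

theorem ContMaps.apply_ne_zero (f : ContMaps) (z : PuncturedPlane) : (f z : ℂ) ≠ 0 := (f z).2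

section Homotopies

variable (s : ℝˣ)

theorem horizontal_mem_slitDomain (x : ℝ) : (x : ℂ) + (s : ℝ) * Complex.I ∈ slitDomain s := by
  intro n _
  simp

theorem vertical_mem_slitDomain (z : slitDomain s) (t : I) :
    ((z : ℂ).re : ℂ) + (((1 - t) * s + t * (z : ℂ).im : ℝ) : ℂ) * Complex.I ∈ slitDomain s := by
  intro n hn
  have h1 : 0 < (s : ℝ) * (z : ℂ).im := z.2 n (by simpa using hn)
  have h2 : 0 < (s : ℝ) * s := mul_self_pos.2 s.ne_zero
  have ht0 := t.2.1
  have ht1 := t.2.2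
  have : 0 < (1 - (t : ℝ)) * (s * s) + t * (s * (z : ℂ).im) := by
    rcases ht0.eq_or_lt with h | h
    · rw [← h]
      simp
    · have := mul_pos h h1
      have := mul_nonneg (sub_nonneg.2 ht1) h2.le
      linarith
  calc 0 < _ := this
    _ = _ := by simp; ring

/-- The horizontal homotopy from a point to the line through `s i`. -/
noncomputable def horizontal (p : I × slitDomain s) : slitDomain s :=
  ⟨_, horizontal_mem_slitDomain s ((p.1 : ℝ) * (p.2 : ℂ).re)⟩

/-- The vertical homotopy from the line through `s i` to the identity. -/
noncomputable def vertical (p : I × slitDomain s) : slitDomain s :=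
  ⟨_, vertical_mem_slitDomain s p.2 p.1⟩

@[fun_prop]
theorem continuous_horizontal : Continuous (horizontal s) :=
  Continuous.subtype_mk (by fun_prop) _

@[fun_prop]
theorem continuous_vertical : Continuous (vertical s) :=
  Continuous.subtype_mk (by fun_prop) _

theorem vertical_zero (z : slitDomain s) : vertical s (0, z) = horizontal s (1, z) :=
  Subtype.ext (by simp [vertical, horizontal])

theorem vertical_one (z : slitDomain s) : vertical s (1, z) = z :=
  Subtype.ext (by simp [vertical])

theorem horizontal_zero (z : slitDomain s) : horizontal s (0, z) = horizontal s (0, 0) :=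
  Subtype.ext (by simp [horizontal])

instance : PathConnectedSpace (slitDomain s) where
  nonempty := ⟨0⟩
  joined := by
    have key : ∀ z : slitDomain s, Joined (horizontal s (0, 0)) z := by
      intro z
      have h1 : Joined (horizontal s (0, 0)) (horizontal s (1, z)) :=
        ⟨{ toFun := fun t => horizontal s (t, z)
           continuous_toFun := by fun_prop
           source' := horizontal_zero s z
           target' := rfl }⟩
      have h2 : Joined (horizontal s (1, z)) z :=
        ⟨{ toFun := fun t => vertical s (t, z)
           continuous_toFun := by fun_prop
           source' := vertical_zero s z
           target' := vertical_one s z }⟩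
      exact h1.trans h2
    exact fun x y => (key x).symm.trans (key y)

/-- The slit domain contracts to `s i` through the line of height `s`. The logarithm `0` at that
point is transported along the horizontal and then the vertical homotopy, and finally normalised at
`0`. -/
theorem exists_slitLog : ∃ G : ContMaps × slitDomain s → ℂ, Continuous G ∧
    (∀ f z, Complex.exp (G (f, z)) = f (slitIncl s z) / f 0) ∧ ∀ f, G (f, 0) = 0 := by
  let b : slitDomain s := horizontal s (0, 0)
  have hne : ∀ (f : ContMaps) z w, (f (slitIncl s z) / f (slitIncl s w) : ℂ) ≠ 0 :=
    fun f z w => div_ne_zero (f.apply_ne_zero _) (f.apply_ne_zero _)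
  have hev : ∀ {T : Type} [TopologicalSpace T] (u : T → ContMaps) (v : T → slitDomain s),
      Continuous u → Continuous v →
      Continuous fun t => (u t (slitIncl s (v t)) / u t (slitIncl s b) : ℂ) := by
    intro T _ u v hu hv
    refine Continuous.div ?_ ?_ fun t => (u t).apply_ne_zero _
    · exact continuous_subtype_val.comp (hu.eval ((slitIncl s).continuous.comp hv))
    · exact continuous_subtype_val.comp (hu.eval continuous_const)
  obtain ⟨g₁, hg₁, hg₁'⟩ := exists_log_of_homotopy (Y := ContMaps × slitDomain s)
    (F := fun p => p.2.1 (slitIncl s (horizontal s (p.1, p.2.2))) / p.2.1 (slitIncl s b))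
    (hev (T := I × ContMaps × slitDomain s) (fun p => p.2.1)
      (fun p => horizontal s (p.1, p.2.2)) (by fun_prop) (by fun_prop))
    (fun p => hne _ _ _) (g₀ := fun _ => 0) continuous_const
    (fun y => by
      simp only [Complex.exp_zero, horizontal_zero s y.2]
      exact (div_self (y.1.apply_ne_zero _)).symm)
  obtain ⟨g₂, hg₂, hg₂'⟩ := exists_log_of_homotopy (Y := ContMaps × slitDomain s)
    (F := fun p => p.2.1 (slitIncl s (vertical s (p.1, p.2.2))) / p.2.1 (slitIncl s b))
    (hev (T := I × ContMaps × slitDomain s) (fun p => p.2.1)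
      (fun p => vertical s (p.1, p.2.2)) (by fun_prop) (by fun_prop))
    (fun p => hne _ _ _) hg₁ (fun y => by simp only [hg₁', vertical_zero])
  refine ⟨fun p => g₂ p - g₂ (p.1, 0), by fun_prop, fun f z => ?_, fun f => sub_self _⟩
  simp only [Complex.exp_sub, hg₂', vertical_one, slitIncl_zero]
  exact div_div_div_cancel_right₀ (f.apply_ne_zero _) _ _

end Homotopies

/-- The logarithm of `f / f 0` on a slit domain that vanishes at `0`. -/
noncomputable def slitLog (s : ℝˣ) : ContMaps × slitDomain s → ℂ := (exists_slitLog s).choose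

@[fun_prop]
theorem continuous_slitLog (s : ℝˣ) : Continuous (slitLog s) := (exists_slitLog s).choose_spec.1

theorem exp_slitLog (s : ℝˣ) (f : ContMaps) (z : slitDomain s) :
    Complex.exp (slitLog s (f, z)) = f (slitIncl s z) / f 0 :=
  (exists_slitLog s).choose_spec.2.1 f z

@[simp] theorem slitLog_zero (s : ℝˣ) (f : ContMaps) : slitLog s (f, 0) = 0 :=
  (exists_slitLog s).choose_spec.2.2 f

theorem slitLog_eq {s : ℝˣ} {f : ContMaps} {g : slitDomain s → ℂ} (hg : Continuous g) {c : ℂ}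
    (h : ∀ z, Complex.exp (g z) = c * f (slitIncl s z)) (z : slitDomain s) :
    slitLog s (f, z) = g z - g 0 := by
  have hc : c ≠ 0 := by
    rintro rfl
    exact Complex.exp_ne_zero _ ((h 0).trans (zero_mul _))
  refine congrFun (eq_of_exp_eq (g := fun z => slitLog s (f, z)) (h := fun z => g z - g 0)
    (by fun_prop) (by fun_prop) (fun z => ?_) 0 (by simp)) z
  rw [exp_slitLog, Complex.exp_sub, h, h, slitIncl_zero, mul_div_mul_left _ _ hc]

theorem slitLog_of_mul {f g h : ContMaps} (hf : ∀ z, (f z : ℂ) = g z * h z) (s : ℝˣ)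
    (z : slitDomain s) : slitLog s (f, z) = slitLog s (g, z) + slitLog s (h, z) := by
  rw [slitLog_eq (f := f) (g := fun z => slitLog s (g, z) + slitLog s (h, z))
    (c := (g 0 * h 0 : ℂ)⁻¹) (by fun_prop)]
  · simp
  · intro z
    rw [Complex.exp_add, exp_slitLog, exp_slitLog, hf]
    field_simp

/-! ### Vertical strips and winding numbers -/

/-- The vertical strips between the punctures; the strip of index `0` is the half-plane to the
left of `1`. -/
def strip (j : ℕ) : Set ℂ := {z | (j ≠ 0 → (j : ℝ) < z.re) ∧ z.re < j + 1}

theorem strip_subset (s : ℝˣ) (j : ℕ) : strip j ⊆ slitDomain s := by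
  rintro z ⟨h1, h2⟩ n hn
  exfalso
  rw [hn] at h1 h2
  have h3 : (n : ℕ) < j + 1 := by exact_mod_cast h2
  rcases eq_or_ne j 0 with rfl | h0
  · have := n.pos
    omega
  · have : j < (n : ℕ) := by exact_mod_cast h1 h0
    omega

theorem convex_strip (j : ℕ) : Convex ℝ (strip j) := by
  have h2 : Convex ℝ {z : ℂ | z.re < (j : ℝ) + 1} := convex_halfSpace_re_lt _
  rcases eq_or_ne j 0 with rfl | h0
  · convert h2 using 1
    ext z
    simp [strip]
  · convert (convex_halfSpace_re_gt (j : ℝ)).inter h2 using 1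
    ext z
    simp [strip, h0]

instance (j : ℕ) : PreconnectedSpace (strip j) :=
  isPreconnected_iff_preconnectedSpace.1 (convex_strip j).isPreconnected

theorem exists_mem_strip {z : ℂ} (h : ∀ n : ℕ+, z.re ≠ n) : ∃ j, z ∈ strip j := by
  refine ⟨⌊z.re⌋₊, fun h0 => ?_, Nat.lt_floor_add_one _⟩
  refine lt_of_le_of_ne (Nat.floor_le (Nat.pos_of_floor_pos (Nat.pos_of_ne_zero h0)).le) ?_
  exact (h ⟨_, Nat.pos_of_ne_zero h0⟩).symm

/-- The inclusion of a strip in a slit domain. -/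
def stripIncl (s : ℝˣ) (j : ℕ) : C(strip j, slitDomain s) :=
  ⟨Set.inclusion (strip_subset s j), continuous_inclusion _⟩

theorem mid_mem_strip (j : ℕ) : (((j : ℝ) + 1 / 2 : ℝ) : ℂ) ∈ strip j := by
  refine ⟨fun _ => ?_, ?_⟩ <;> rw [Complex.ofReal_re] <;> linarith

/-- The midpoint of the real interval in a strip. -/
noncomputable def mid (j : ℕ) : strip j := ⟨_, mid_mem_strip j⟩

/-- The difference of the two logarithms of `f` on a strip. -/
noncomputable def logJump (j : ℕ) (f : ContMaps) : ℂ :=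
  slitLog 1 (f, stripIncl 1 j (mid j)) - slitLog (-1) (f, stripIncl (-1) j (mid j))

@[fun_prop]
theorem continuous_logJump (j : ℕ) : Continuous (logJump j) := by
  unfold logJump
  fun_prop

theorem exp_slitLog_sub_slitLog (j : ℕ) (f : ContMaps) (z : strip j) :
    Complex.exp (slitLog 1 (f, stripIncl 1 j z) - slitLog (-1) (f, stripIncl (-1) j z)) = 1 := by
  rw [Complex.exp_sub, exp_slitLog, exp_slitLog]
  exact div_self (div_ne_zero (f.apply_ne_zero _) (f.apply_ne_zero _))

theorem slitLog_sub_slitLog (j : ℕ) (f : ContMaps) (z : strip j) :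
    slitLog 1 (f, stripIncl 1 j z) - slitLog (-1) (f, stripIncl (-1) j z) = logJump j f :=
  congrFun (eq_of_exp_eq (h := fun _ => logJump j f)
    (g := fun z => slitLog 1 (f, stripIncl 1 j z) - slitLog (-1) (f, stripIncl (-1) j z))
    (by fun_prop) continuous_const
    (fun z => by rw [exp_slitLog_sub_slitLog, logJump, exp_slitLog_sub_slitLog]) (mid j) rfl) z

/-- The strip of index `0` contains the point `0`, where both logarithms vanish. -/
theorem logJump_zero (f : ContMaps) : logJump 0 f = 0 := by
  have h := slitLog_sub_slitLog 0 f ⟨0, by simp [strip]⟩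
  rw [← h]
  have h1 : ∀ s, slitLog s (f, stripIncl s 0 ⟨0, by simp [strip]⟩) = 0 := fun s => slitLog_zero s f
  rw [h1, h1, sub_zero]

theorem exists_winding (n : ℕ+) (f : ContMaps) :
    ∃ k : ℤ, logJump n.natPred f - logJump n f = k * (2 * Real.pi * Complex.I) := by
  rw [← Complex.exp_eq_one_iff, Complex.exp_sub, logJump, logJump, exp_slitLog_sub_slitLog,
    exp_slitLog_sub_slitLog, div_one]

/-- The winding number of `f` about a puncture. -/
noncomputable def winding (n : ℕ+) (f : ContMaps) : ℤ := (exists_winding n f).choose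

theorem winding_spec (n : ℕ+) (f : ContMaps) :
    logJump n.natPred f - logJump n f = winding n f * (2 * Real.pi * Complex.I) :=
  (exists_winding n f).choose_spec

theorem winding_eq {n : ℕ+} {f : ContMaps} {k : ℤ}
    (h : logJump n.natPred f - logJump n f = k * (2 * Real.pi * Complex.I)) : winding n f = k := by
  rw [winding_spec] at h
  exact_mod_cast mul_right_cancel₀ Complex.two_pi_I_ne_zero h

theorem continuous_winding (n : ℕ+) : Continuous (winding n) := by
  rw [Complex.isClosedEmbedding_intCast.isEmbedding.continuous_iff]
  have h : ((↑) : ℤ → ℂ) ∘ winding n =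
      fun f => (logJump n.natPred f - logJump n f) / (2 * Real.pi * Complex.I) := by
    ext f
    rw [winding_spec, mul_div_cancel_right₀ _ Complex.two_pi_I_ne_zero]
    rfl
  rw [h]
  fun_prop

theorem winding_of_mul {f g h : ContMaps} (hf : ∀ z, (f z : ℂ) = g z * h z) (n : ℕ+) :
    winding n f = winding n g + winding n h := by
  apply winding_eq
  have hg := winding_spec n g
  have hh := winding_spec n h
  simp only [logJump, slitLog_of_mul hf] at hg hh ⊢
  push_cast
  linear_combination hg + hh

theorem logJump_eq_zero {f : ContMaps} (h : ∀ n, winding n f = 0) : ∀ j, logJump j f = 0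
  | 0 => logJump_zero f
  | j + 1 => by
    have := winding_spec j.succPNat f
    rw [h, Int.cast_zero, zero_mul, Nat.natPred_succPNat, logJump_eq_zero h j, zero_sub,
      neg_eq_zero] at this
    exact this

theorem Joined.winding_eq {f g : ContMaps} (h : Joined f g) (n : ℕ+) :
    winding n f = winding n g := by
  obtain ⟨γ⟩ := h.map (continuous_winding n)
  have := PreconnectedSpace.constant (Y := ℤ) inferInstance γ.continuous (x := 0) (y := 1)
  rwa [γ.source, γ.target] at this

/-! ### Agreement with the winding number along a circle -/

theorem re_ofReal_add_ofReal_mul_I (x y : ℝ) : ((x : ℂ) + (y : ℂ) * Complex.I).re = x := by simp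

theorem im_ofReal_add_ofReal_mul_I (x y : ℝ) : ((x : ℂ) + (y : ℂ) * Complex.I).im = y := by simp

theorem coe_punctureLoop (n : ℕ+) (t : I) : (punctureLoop n t : ℂ) =
    ((n + Real.cos (2 * Real.pi * t) / 2 : ℝ) : ℂ) +
      ((Real.sin (2 * Real.pi * t) / 2 : ℝ) : ℂ) * Complex.I := by
  have h : (2 * Real.pi * Complex.I * (t : ℝ) : ℂ) =
      ((2 * Real.pi * t : ℝ) : ℂ) * Complex.I := by
    push_cast
    ring
  change (n : ℂ) + (1 / 2 : ℂ) * Complex.exp (2 * Real.pi * Complex.I * (t : ℝ)) = _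
  rw [h, Complex.exp_mul_I, ← Complex.ofReal_cos, ← Complex.ofReal_sin]
  push_cast
  ring

/-- The weak inequality suffices: where the sine vanishes, the real part is `n ± 1 / 2` and no ray
is met. -/
theorem punctureLoop_mem_slitDomain {s : ℝˣ} {n : ℕ+} {t : I}
    (h : 0 ≤ (s : ℝ) * Real.sin (2 * Real.pi * t)) :
    (punctureLoop n t : ℂ) ∈ slitDomain s := by
  intro m hm
  rw [coe_punctureLoop, re_ofReal_add_ofReal_mul_I] at hm
  rw [coe_punctureLoop, im_ofReal_add_ofReal_mul_I]
  have h1 : (2 * ((m : ℤ) - (n : ℤ) : ℤ) : ℝ) = Real.cos (2 * Real.pi * t) := by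
    push_cast
    linarith
  have h2 : |((m : ℤ) - (n : ℤ) : ℤ)| < 1 := by
    have h3 := Real.abs_cos_le_one (2 * Real.pi * t)
    rw [← h1, abs_mul, abs_two] at h3
    have : |(((m : ℤ) - (n : ℤ) : ℤ) : ℝ)| < 1 := by linarith
    exact_mod_cast this
  rw [Int.abs_lt_one_iff] at h2
  rw [h2] at h1
  have h4 : Real.sin (2 * Real.pi * t) ≠ 0 := fun h0 => by
    have := Real.sin_sq_add_cos_sq (2 * Real.pi * t)
    rw [h0, ← h1] at this
    norm_num at this
  have h5 := lt_of_le_of_ne h (mul_ne_zero s.ne_zero h4).symm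
  linarith

/-- The midpoint of the unit interval. -/
noncomputable def unitHalf : I := ⟨1 / 2, by norm_num, by norm_num⟩

theorem punctureLoop_min_mem (n : ℕ+) (t : I) :
    (punctureLoop n (min t unitHalf) : ℂ) ∈ slitDomain 1 := by
  apply punctureLoop_mem_slitDomain
  have h : ((min t unitHalf : I) : ℝ) ≤ 1 / 2 := min_le_right t unitHalf
  have h0 := (min t unitHalf).2.1
  rw [Units.val_one, one_mul]
  exact Real.sin_nonneg_of_nonneg_of_le_pi (by positivity) (by nlinarith [Real.pi_pos])

theorem punctureLoop_max_mem (n : ℕ+) (t : I) :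
    (punctureLoop n (max t unitHalf) : ℂ) ∈ slitDomain (-1) := by
  apply punctureLoop_mem_slitDomain
  have h : 1 / 2 ≤ ((max t unitHalf : I) : ℝ) := le_max_right t unitHalf
  have h1 := (max t unitHalf).2.2
  have h2 := Real.sin_nonneg_of_nonneg_of_le_pi
    (x := 2 * Real.pi * (max t unitHalf : I) - Real.pi)
    (by nlinarith [Real.pi_pos]) (by nlinarith [Real.pi_pos])
  rw [Real.sin_sub_pi] at h2
  rw [Units.val_neg, Units.val_one, neg_one_mul]
  exact h2

theorem coe_punctureLoop_half (n : ℕ+) : (punctureLoop n unitHalf : ℂ) = mid n.natPred := by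
  have h : (2 * Real.pi * (1 / 2) : ℝ) = Real.pi := by ring
  have hn : ((n : ℕ) : ℂ) = n.natPred + 1 := by exact_mod_cast n.natPred_add_one.symm
  rw [coe_punctureLoop]
  simp only [unitHalf, mid, h, Real.cos_pi, Real.sin_pi]
  push_cast
  rw [hn]
  ring

theorem coe_punctureLoop_zero (n : ℕ+) : (punctureLoop n 0 : ℂ) = mid n := by
  rw [coe_punctureLoop]
  simp [mid]

theorem coe_punctureLoop_one (n : ℕ+) : (punctureLoop n 1 : ℂ) = mid n := by
  rw [coe_punctureLoop]
  simp [mid]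

/-- The circle goes from `n + 1/2` to `n - 1/2` above the puncture and returns below it, so the
logarithm grows along it by the difference of the two jumps. Clamping the time at `1/2` by `min` and
`max` lets the logarithms of both halves be added instead of glued. -/
theorem hasWindingNumber_winding (n : ℕ+) (f : ContMaps) :
    HasWindingNumber f n (winding n f) := by
  let p : C(I, slitDomain 1) := ⟨fun t => ⟨_, punctureLoop_min_mem n t⟩,
    Continuous.subtype_mk (by fun_prop) _⟩
  let q : C(I, slitDomain (-1)) := ⟨fun t => ⟨_, punctureLoop_max_mem n t⟩,
    Continuous.subtype_mk (by fun_prop) _⟩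
  have hp : ∀ t, slitIncl 1 (p t) = punctureLoop n (min t unitHalf) := fun t => rfl
  have hq : ∀ t, slitIncl (-1) (q t) = punctureLoop n (max t unitHalf) := fun t => rfl
  have hf := f.apply_ne_zero
  refine ⟨⟨fun t => slitLog 1 (f, p t) + slitLog (-1) (f, q t) - slitLog (-1) (f, q 0) +
    Complex.log (f 0), by fun_prop⟩, fun t => ?_, ?_⟩
  · simp only [ContinuousMap.coe_mk, Complex.exp_add, Complex.exp_sub, exp_slitLog,
      Complex.exp_log (hf 0), hp, hq]
    have h0 : max (0 : I) unitHalf = unitHalf := max_eq_right (α := I) unitHalf.2.1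
    rw [h0]
    have h1 := hf 0
    have h2 := hf (punctureLoop n unitHalf)
    rcases le_total t unitHalf with h | h
    · rw [min_eq_left h, max_eq_right h]
      field_simp
    · rw [min_eq_right h, max_eq_left h]
      field_simp
  · have p0 : p 0 = stripIncl 1 n (mid n) := Subtype.ext <| by
      rw [show ((p 0 : slitDomain 1) : ℂ) = punctureLoop n (min 0 unitHalf) from rfl,
        min_eq_left (α := I) unitHalf.2.1, coe_punctureLoop_zero]
      rfl
    have p1 : p 1 = stripIncl 1 n.natPred (mid n.natPred) := Subtype.ext <| by
      rw [show ((p 1 : slitDomain 1) : ℂ) = punctureLoop n (min 1 unitHalf) from rfl,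
        min_eq_right (α := I) unitHalf.2.2, coe_punctureLoop_half]
      rfl
    have q0 : q 0 = stripIncl (-1) n.natPred (mid n.natPred) := Subtype.ext <| by
      rw [show ((q 0 : slitDomain (-1)) : ℂ) = punctureLoop n (max 0 unitHalf) from rfl,
        max_eq_right (α := I) unitHalf.2.1, coe_punctureLoop_half]
      rfl
    have q1 : q 1 = stripIncl (-1) n (mid n) := Subtype.ext <| by
      rw [show ((q 1 : slitDomain (-1)) : ℂ) = punctureLoop n (max 1 unitHalf) from rfl,
        max_eq_left (α := I) unitHalf.2.2, coe_punctureLoop_one]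
      rfl
    have h := winding_spec n f
    simp only [logJump] at h
    simp only [ContinuousMap.coe_mk, p0, p1, q0, q1]
    linear_combination h

/-! ### Winding numbers of Weierstrass products -/

/-- Multiplication by `s i` turns the image of the removed ray at `m + 1` into the nonpositive real
axis, so the principal logarithm applies on the whole slit domain. -/
theorem mul_one_sub_div_mem_slitPlane {s : ℝˣ} (m : ℕ) (z : slitDomain s) :
    (s : ℝ) * Complex.I * (1 - (z : ℂ) / (m + 1)) ∈ Complex.slitPlane := by
  have hm : (0 : ℝ) < m + 1 := by positivity
  have hdiv : (s : ℝ) * Complex.I * (1 - (z : ℂ) / (m + 1)) =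
      (((s : ℝ) * ((z : ℂ).im / (m + 1)) : ℝ) : ℂ) +
      (((s : ℝ) * (1 - (z : ℂ).re / (m + 1)) : ℝ) : ℂ) * Complex.I := by
    push_cast
    conv_lhs => rw [← Complex.re_add_im (z : ℂ)]
    linear_combination (-(s : ℝ) * (z : ℂ).im / (m + 1) : ℂ) * Complex.I_sq
  rw [Complex.mem_slitPlane_iff, hdiv, re_ofReal_add_ofReal_mul_I, im_ofReal_add_ofReal_mul_I]
  by_cases h : (z : ℂ).re = m + 1
  · left
    have h1 := z.2 m.succPNat (by simpa using h)
    have h2 := div_pos h1 hm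
    rwa [mul_div_assoc] at h2
  · right
    have : 1 - (z : ℂ).re / (m + 1) ≠ 0 := by
      rw [sub_ne_zero, ne_comm, Ne, div_eq_one_iff_eq hm.ne']
      exact h
    exact mul_ne_zero s.ne_zero this

theorem log_jump_of_pos {x : ℝ} (hx : 0 < x) :
    (Complex.log (Complex.I * x) - Complex.log Complex.I) -
      (Complex.log (-Complex.I * x) - Complex.log (-Complex.I)) = 0 := by
  rw [mul_comm, Complex.log_ofReal_mul hx Complex.I_ne_zero, mul_comm,
    Complex.log_ofReal_mul hx (neg_ne_zero.2 Complex.I_ne_zero)]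
  ring

theorem log_jump_of_neg {x : ℝ} (hx : x < 0) :
    (Complex.log (Complex.I * x) - Complex.log Complex.I) -
      (Complex.log (-Complex.I * x) - Complex.log (-Complex.I)) =
      -(2 * Real.pi * Complex.I) := by
  have h1 : Complex.I * x = ((-x : ℝ) : ℂ) * -Complex.I := by push_cast; ring
  have h2 : -Complex.I * x = ((-x : ℝ) : ℂ) * Complex.I := by push_cast; ring
  rw [h1, h2, Complex.log_ofReal_mul (neg_pos.2 hx) Complex.I_ne_zero,
    Complex.log_ofReal_mul (neg_pos.2 hx) (neg_ne_zero.2 Complex.I_ne_zero),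
    Complex.log_I, Complex.log_neg_I]
  ring

/-- The exponents `P m` are single-valued and drop out of the jumps. The factor with zero `m + 1`
contributes `-2πi * k m` to the jump of every strip to the right of that zero, so only `m = n - 1`
survives in the difference. -/
theorem winding_of_eq_prod {f : ContMaps} {S : Finset ℕ} {k : ℕ → ℤ} {P : ℕ → ℂ → ℂ}
    (hP : ∀ m, Continuous (P m))
    (hf : ∀ z : PuncturedPlane,
      (f z : ℂ) = ∏ m ∈ S, ((1 - (z : ℂ) / (m + 1)) * Complex.exp (P m z)) ^ k m) (n : ℕ+) :
    winding n f = if n.natPred ∈ S then k n.natPred else 0 := by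
  have hlog : ∀ (s : ℝˣ) (z : slitDomain s), slitLog s (f, z) =
      ∑ m ∈ S, k m * (Complex.log ((s : ℝ) * Complex.I * (1 - (z : ℂ) / (m + 1))) + P m z) -
      ∑ m ∈ S, k m * (Complex.log ((s : ℝ) * Complex.I) + P m 0) := by
    intro s z
    rw [slitLog_eq (f := f) (c := ∏ m ∈ S, ((s : ℝ) * Complex.I) ^ k m) (g := fun z =>
      ∑ m ∈ S, k m * (Complex.log ((s : ℝ) * Complex.I * (1 - (z : ℂ) / (m + 1))) + P m z))]
    · simp
    · refine continuous_finsetSum _ fun m _ => continuous_const.mul (Continuous.add ?_ ?_)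
      · exact Continuous.clog (by fun_prop) fun z => mul_one_sub_div_mem_slitPlane m z
      · exact (hP m).comp continuous_subtype_val
    · intro z
      rw [Complex.exp_sum, hf, ← Finset.prod_mul_distrib]
      refine Finset.prod_congr rfl fun m _ => ?_
      rw [Complex.exp_int_mul, Complex.exp_add, Complex.exp_log
        (Complex.slitPlane_ne_zero (mul_one_sub_div_mem_slitPlane m z)), mul_assoc, mul_zpow,
        coe_slitIncl]
  have hjump : ∀ j : ℕ, logJump j f =
      ∑ m ∈ S, k m * (if m < j then -(2 * Real.pi * Complex.I) else 0) := by
    intro j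
    simp only [logJump, hlog]
    rw [← Finset.sum_sub_distrib, ← Finset.sum_sub_distrib, ← Finset.sum_sub_distrib]
    refine Finset.sum_congr rfl fun m _ => ?_
    have hm : (0 : ℝ) < m + 1 := by positivity
    -- The value of the linear factor at the midpoint of the strip; it is negative exactly when `m <
    -- j`.
    let x : ℝ := 1 - (j + 1 / 2) / (m + 1)
    have hx : ∀ s, 1 - ((stripIncl s j (mid j) : slitDomain s) : ℂ) / (m + 1) = (x : ℂ) := by
      intro s
      change 1 - (((j : ℝ) + 1 / 2 : ℝ) : ℂ) / (m + 1) = (x : ℂ)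
      simp only [x]
      push_cast
      ring
    have hP' : ∀ s, P m ((stripIncl s j (mid j) : slitDomain s) : ℂ) = P m (mid j) := fun _ => rfl
    rw [hx, hx, hP', hP', ← mul_sub, ← mul_sub, ← mul_sub]
    congr 1
    have hs : (((1 : ℝˣ) : ℝ) : ℂ) * Complex.I = Complex.I := by simp
    have hs' : (((-1 : ℝˣ) : ℝ) : ℂ) * Complex.I = -Complex.I := by simp
    rw [hs, hs']
    split_ifs with hmj
    · rw [← log_jump_of_neg (x := x)]
      · ring
      · have : (m : ℝ) + 1 ≤ j := by exact_mod_cast hmj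
        rw [sub_neg, one_lt_div hm]
        linarith
    · rw [← log_jump_of_pos (x := x)]
      · ring
      · have : (j : ℝ) ≤ m := by exact_mod_cast not_lt.1 hmj
        rw [sub_pos, div_lt_one hm]
        linarith
  apply winding_eq
  rw [hjump, hjump, ← Finset.sum_sub_distrib]
  have hterm : ∀ m ∈ S, (k m * (if m < n.natPred then -(2 * Real.pi * Complex.I) else 0) -
      k m * (if m < (n : ℕ) then -(2 * Real.pi * Complex.I) else 0) : ℂ) =
      if n.natPred = m then k m * (2 * Real.pi * Complex.I) else 0 := by
    intro m _
    have hn := n.natPred_add_one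
    split_ifs <;> first | omega | ring
  rw [Finset.sum_congr rfl hterm, Finset.sum_ite_eq]
  split_ifs <;> simp

/-! ### Holomorphic maps with prescribed winding numbers -/

/-- `P` is minus a Taylor polynomial of `log (1 - z / (n + 1))`, whose degree grows with `|k|` so
that the bound does not depend on `k`. -/
theorem exists_convergence_factor (n : ℕ) (k : ℤ) : ∃ P : ℂ → ℂ, Differentiable ℂ P ∧
    ∀ z : ℂ, ‖z‖ ≤ (n + 1) / 2 →
      ‖((1 - z / (n + 1)) * Complex.exp (P z)) ^ k - 1‖ ≤ (1 / 2 : ℝ) ^ n := by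
  -- `|k| ≤ N + 1` lets the denominator of the Taylor remainder absorb the power `k`; `n + 1 ≤ N`
  -- pays for the factor 2 in `‖exp x - 1‖ ≤ 2 * ‖x‖`.
  let N := n + k.natAbs + 1
  have hn : (0 : ℝ) < n + 1 := by positivity
  refine ⟨fun z => -Complex.logTaylor (N + 1) (-(z / (n + 1))), ?_, fun z hz => ?_⟩
  · have : Differentiable ℂ (Complex.logTaylor (N + 1)) := fun z =>
      (Complex.hasDerivAt_logTaylor N z).differentiableAt
    exact (this.comp (differentiable_id.div_const _).neg).neg
  let w : ℂ := -(z / (n + 1))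
  have hw : ‖w‖ ≤ 1 / 2 := by
    have : ‖((n : ℂ) + 1)‖ = n + 1 := by
      rw [← Nat.cast_succ, Complex.norm_natCast, Nat.cast_succ]
    rw [norm_neg, norm_div, this, div_le_iff₀ hn]
    linarith
  have hw1 : 1 + w ≠ 0 := fun h => by
    have : w = -1 := by linear_combination h
    rw [this] at hw
    norm_num at hw
  have hlog := Complex.norm_log_sub_logTaylor_le N (hw.trans_lt (by norm_num))
  let x : ℂ := k * (Complex.log (1 + w) - Complex.logTaylor (N + 1) w)
  have hx : ((1 - z / (n + 1)) * Complex.exp (-Complex.logTaylor (N + 1) w)) ^ k =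
      Complex.exp x := by
    rw [Complex.exp_int_mul, Complex.exp_sub, Complex.exp_log hw1, Complex.exp_neg, sub_eq_add_neg]
    rfl
  have hN : (0 : ℝ) < N + 1 := by positivity
  have hkN : |(k : ℝ)| ≤ N + 1 := by
    rw [← Int.cast_abs, ← Nat.cast_natAbs]
    simp only [N]
    push_cast
    linarith [(Nat.cast_nonneg n : (0 : ℝ) ≤ n)]
  have hinv : (1 - ‖w‖)⁻¹ ≤ 2 := by
    rw [inv_le_comm₀ (by linarith) two_pos]
    linarith
  have hx1 : ‖x‖ ≤ (1 / 2) ^ N := by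
    have h1 : ‖w‖ ^ (N + 1) * (1 - ‖w‖)⁻¹ ≤ (1 / 2) ^ (N + 1) * 2 :=
      mul_le_mul (pow_le_pow_left₀ (norm_nonneg _) hw _) hinv
        (inv_nonneg.2 (by linarith)) (by positivity)
    calc ‖x‖ = |(k : ℝ)| * ‖Complex.log (1 + w) - Complex.logTaylor (N + 1) w‖ := by
          rw [norm_mul, Complex.norm_intCast]
      _ ≤ (N + 1) * ((1 / 2) ^ (N + 1) * 2 / (N + 1)) :=
          mul_le_mul hkN (hlog.trans (div_le_div_of_nonneg_right h1 hN.le)) (norm_nonneg _) hN.le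
      _ = (1 / 2) ^ N := by
          field_simp
          ring
  have hNn : (1 / 2 : ℝ) ^ N ≤ (1 / 2) ^ (n + 1) :=
    pow_le_pow_of_le_one (by norm_num) (by norm_num) (by omega)
  have hx2 : ‖x‖ ≤ 1 := hx1.trans (pow_le_one₀ (by norm_num) (by norm_num))
  change ‖((1 - z / (n + 1)) * Complex.exp (-Complex.logTaylor (N + 1) w)) ^ k - 1‖ ≤ _
  rw [hx]
  calc _ ≤ 2 * ‖x‖ := Complex.norm_exp_sub_one_le hx2
    _ ≤ 2 * (1 / 2) ^ (n + 1) := by linarith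
    _ = (1 / 2) ^ n := by ring

/-- The exponent of the convergence factor at the puncture `n + 1` for multiplicity `k`. -/
noncomputable def convExponent (n : ℕ) (k : ℤ) : ℂ → ℂ := (exists_convergence_factor n k).choose

theorem differentiable_convExponent (n : ℕ) (k : ℤ) : Differentiable ℂ (convExponent n k) :=
  (exists_convergence_factor n k).choose_spec.1

/-- The Weierstrass factor with a zero of order `k` at `n + 1`. -/
noncomputable def weierstrassFactor (n : ℕ) (k : ℤ) (z : ℂ) : ℂ :=
  ((1 - z / (n + 1)) * Complex.exp (convExponent n k z)) ^ k

theorem norm_weierstrassFactor_sub_one_le {n : ℕ} {z : ℂ} (k : ℤ) (hz : ‖z‖ ≤ (n + 1) / 2) :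
    ‖weierstrassFactor n k z - 1‖ ≤ (1 / 2 : ℝ) ^ n :=
  (exists_convergence_factor n k).choose_spec.2 z hz

theorem weierstrassFactor_base_ne_zero (n : ℕ) (k : ℤ) {z : ℂ} (hz : z ∈ PuncturedPlane) :
    (1 - z / (n + 1)) * Complex.exp (convExponent n k z) ≠ 0 := by
  refine mul_ne_zero (fun h => hz n.succPNat ?_) (Complex.exp_ne_zero _)
  have hn : (n : ℂ) + 1 ≠ 0 := Nat.cast_add_one_ne_zero n
  rw [sub_eq_zero, eq_div_iff hn, one_mul] at h
  simp [← h]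

theorem weierstrassFactor_ne_zero (n : ℕ) (k : ℤ) {z : ℂ} (hz : z ∈ PuncturedPlane) :
    weierstrassFactor n k z ≠ 0 :=
  zpow_ne_zero _ (weierstrassFactor_base_ne_zero n k hz)

theorem differentiableOn_weierstrassFactor (n : ℕ) (k : ℤ) :
    DifferentiableOn ℂ (weierstrassFactor n k) PuncturedPlane := by
  intro z hz
  refine DifferentiableAt.differentiableWithinAt ?_
  refine DifferentiableAt.zpow ?_ (.inl (weierstrassFactor_base_ne_zero n k hz))
  have := differentiable_convExponent n k z
  fun_prop

/-- The exponent was chosen separately for each `k`, which is harmless because `ℤ` is discrete. -/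
theorem continuous_weierstrassFactor (n : ℕ) : Continuous
    fun p : (ℕ+ → ℤ) × PuncturedPlane => weierstrassFactor n (p.1 n.succPNat) p.2 := by
  have h : Continuous fun p : ℤ × PuncturedPlane => weierstrassFactor n p.1 p.2 :=
    continuous_prod_of_discrete_left.2 fun k =>
      (differentiableOn_weierstrassFactor n k).continuousOn.comp_continuous
        continuous_subtype_val fun z => z.2
  exact h.comp (f := fun p : (ℕ+ → ℤ) × PuncturedPlane => (p.1 n.succPNat, p.2)) (by fun_prop)

theorem eventually_norm_weierstrassFactor_sub_one_le (R : ℝ) : ∀ᶠ n : ℕ in Filter.atTop,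
    ∀ (k : ℤ) (z : ℂ), ‖z‖ ≤ R → ‖weierstrassFactor n k z - 1‖ ≤ (1 / 2 : ℝ) ^ n := by
  obtain ⟨N, hN⟩ := exists_nat_ge (2 * R)
  filter_upwards [Filter.eventually_ge_atTop N] with n hn k z hz
  have : (N : ℝ) ≤ n := by exact_mod_cast hn
  exact norm_weierstrassFactor_sub_one_le k (by linarith)

theorem summable_half_pow : Summable fun n : ℕ => (1 / 2 : ℝ) ^ n :=
  summable_geometric_of_lt_one (by norm_num) (by norm_num)

/-- The Weierstrass product with divisor `ν`. -/
noncomputable def weierstrassProd (ν : ℕ+ → ℤ) (z : ℂ) : ℂ :=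
  ∏' n : ℕ, (1 + (weierstrassFactor n (ν n.succPNat) z - 1))

theorem weierstrassProd_ne_zero (ν : ℕ+ → ℤ) {z : ℂ} (hz : z ∈ PuncturedPlane) :
    weierstrassProd ν z ≠ 0 := by
  refine tprod_one_add_ne_zero_of_summable (fun n => ?_) ?_
  · rw [add_sub_cancel]
    exact weierstrassFactor_ne_zero n _ hz
  · refine Summable.of_norm_bounded_eventually_nat summable_half_pow ?_
    filter_upwards [eventually_norm_weierstrassFactor_sub_one_le ‖z‖] with n hn
    rw [norm_norm]
    exact hn _ z le_rfl

theorem tendstoUniformlyOn_weierstrassProd {K : Set ((ℕ+ → ℤ) × PuncturedPlane)}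
    (hK : IsCompact K) : TendstoUniformlyOn
      (fun M p => ∏ n ∈ Finset.range M, weierstrassFactor n (p.1 n.succPNat) p.2)
      (fun p => weierstrassProd p.1 p.2) Filter.atTop K := by
  obtain ⟨R, hR⟩ := (hK.image (f := fun p => (p.2 : ℂ)) (by fun_prop)).isBounded.exists_norm_le
  have h := Summable.hasProdUniformlyOn_nat_one_add
    (f := fun n (p : (ℕ+ → ℤ) × PuncturedPlane) => weierstrassFactor n (p.1 n.succPNat) p.2 - 1)
    hK summable_half_pow (by
      filter_upwards [eventually_norm_weierstrassFactor_sub_one_le R] with n hn p hp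
      exact hn _ _ (hR _ ⟨p, hp, rfl⟩))
    fun n => ((continuous_weierstrassFactor n).sub continuous_const).continuousOn
  simpa only [weierstrassProd, add_sub_cancel] using h.tendstoUniformlyOn_finsetRange

theorem continuous_weierstrassProd :
    Continuous fun p : (ℕ+ → ℤ) × PuncturedPlane => weierstrassProd p.1 p.2 := by
  rw [CompactlyCoherentSpace.isCoherentWith.continuous_iff]
  intro K hK
  refine (tendstoUniformlyOn_weierstrassProd hK).continuousOn (Filter.Frequently.of_forall ?_)
  exact fun M => (continuous_finsetProd _ fun n _ => continuous_weierstrassFactor n).continuousOn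

theorem differentiableOn_weierstrassProd (ν : ℕ+ → ℤ) :
    DifferentiableOn ℂ (weierstrassProd ν) PuncturedPlane := by
  have h : HasProdLocallyUniformlyOn
      (fun (n : ℕ) z => 1 + (weierstrassFactor n (ν n.succPNat) z - 1))
      (weierstrassProd ν) PuncturedPlane := by
    refine hasProdLocallyUniformlyOn_of_forall_compact isOpen_puncturedPlane fun K hKS hK => ?_
    obtain ⟨R, hR⟩ := hK.isBounded.exists_norm_le
    refine Summable.hasProdUniformlyOn_nat_one_add hK summable_half_pow ?_ fun n =>
      (((differentiableOn_weierstrassFactor n _).continuousOn.mono hKS).sub continuousOn_const)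
    filter_upwards [eventually_norm_weierstrassFactor_sub_one_le R] with n hn z hz
    exact hn _ _ (hR z hz)
  refine h.tendstoLocallyUniformlyOn_finsetRange.differentiableOn
    (Filter.Eventually.of_forall fun M => ?_) isOpen_puncturedPlane
  simp only [add_sub_cancel]
  exact DifferentiableOn.fun_finsetProd fun n _ => differentiableOn_weierstrassFactor n _

/-- The Weierstrass product as a continuous map of punctured planes. -/
noncomputable def divisorMap : C(ℕ+ → ℤ, ContMaps) :=
  ContinuousMap.curry ⟨fun p => ⟨weierstrassProd p.1 p.2, weierstrassProd_ne_zero p.1 p.2.2⟩,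
    continuous_weierstrassProd.subtype_mk _⟩

@[simp] theorem coe_divisorMap (ν : ℕ+ → ℤ) (z : PuncturedPlane) :
    (divisorMap ν z : ℂ) = weierstrassProd ν z := rfl

theorem divisorMap_mem_holMaps (ν : ℕ+ → ℤ) : divisorMap ν ∈ HolMaps :=
  ⟨weierstrassProd ν, differentiableOn_weierstrassProd ν, fun _ => rfl⟩

/-- The partial Weierstrass products. -/
noncomputable def partialProd (ν : ℕ+ → ℤ) (M : ℕ) : ContMaps :=
  ⟨fun z => ⟨∏ n ∈ Finset.range M, weierstrassFactor n (ν n.succPNat) z,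
    Finset.prod_ne_zero_iff.2 fun n _ => weierstrassFactor_ne_zero n _ z.2⟩,
    Continuous.subtype_mk (continuous_finsetProd _ fun n _ =>
      (continuous_weierstrassFactor n).comp (.prodMk_right ν)) _⟩

theorem tendsto_partialProd (ν : ℕ+ → ℤ) :
    Filter.Tendsto (partialProd ν) Filter.atTop (𝓝 (divisorMap ν)) := by
  rw [ContinuousMap.tendsto_iff_forall_isCompact_tendstoUniformlyOn]
  intro K hK
  have h := (tendstoUniformlyOn_weierstrassProd
    (hK.image (f := fun z => (ν, z)) (by fun_prop))).comp (fun z => (ν, z))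
  rw [Metric.tendstoUniformlyOn_iff] at h ⊢
  exact fun ε hε => (h ε hε).mono fun M hM z hz => hM z ⟨z, hz, rfl⟩

/-- The partial products converge in the compact-open topology and eventually have winding number `ν
n`; the winding number is continuous. -/
theorem winding_divisorMap (ν : ℕ+ → ℤ) (n : ℕ+) : winding n (divisorMap ν) = ν n := by
  refine tendsto_nhds_unique
    (((continuous_winding n).tendsto _).comp (tendsto_partialProd ν)) ?_
  refine tendsto_const_nhds.congr' ?_
  filter_upwards [Filter.eventually_gt_atTop n.natPred] with M hM
  have h := winding_of_eq_prod (f := partialProd ν M) (S := Finset.range M)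
    (k := fun m => ν m.succPNat) (P := fun m => convExponent m (ν m.succPNat))
    (fun m => (differentiable_convExponent m _).continuous) (fun z => rfl) n
  rw [if_pos (Finset.mem_range.2 hM), PNat.succPNat_natPred] at h
  exact h.symm

/-- If the component of `s 0` were open, it would contain `s` of some unit sequence, whose winding
number about its own puncture is 1 and not 0. -/
theorem not_openPathComponents {X : Type*} [TopologicalSpace X] (s : C(ℕ+ → ℤ, X))
    (p : C(X, ContMaps)) (hp : ∀ ν n, winding n (p (s ν)) = ν n) : ¬ OpenPathComponents X := by
  intro h
  have hlim : Filter.Tendsto (fun n : ℕ => (Pi.single n.succPNat 1 : ℕ+ → ℤ)) Filter.atTop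
      (𝓝 0) := by
    rw [tendsto_pi_nhds]
    intro m
    refine tendsto_const_nhds.congr' ?_
    filter_upwards [Filter.eventually_ge_atTop (m : ℕ)] with n hn
    rw [Pi.single_eq_of_ne]
    · rfl
    · rintro rfl
      simp at hn
  obtain ⟨n, hn⟩ := ((s.continuous.tendsto 0).comp hlim |>.eventually (h (s 0))).exists
  have := (Joined.map hn p.continuous).winding_eq n.succPNat
  simp [hp] at this

/-! ### Holomorphic functions on the punctured plane -/

/-- The holomorphic functions in the space of continuous functions. -/
def HolFuns : Set C(PuncturedPlane, ℂ) :=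
  {g | ∃ F : ℂ → ℂ, DifferentiableOn ℂ F PuncturedPlane ∧ ∀ z : PuncturedPlane, F z = g z}

open Classical in
/-- Extension by zero to the plane. -/
noncomputable def extendZero (g : C(PuncturedPlane, ℂ)) (z : ℂ) : ℂ :=
  if h : z ∈ PuncturedPlane then g ⟨z, h⟩ else 0

theorem extendZero_coe (g : C(PuncturedPlane, ℂ)) (z : PuncturedPlane) :
    extendZero g z = g z := dif_pos z.2

theorem mem_holFuns_iff {g : C(PuncturedPlane, ℂ)} :
    g ∈ HolFuns ↔ DifferentiableOn ℂ (extendZero g) PuncturedPlane := by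
  constructor
  · rintro ⟨F, hF, hFg⟩
    exact hF.congr fun z hz => (extendZero_coe g ⟨z, hz⟩).trans (hFg ⟨z, hz⟩).symm
  · exact fun h => ⟨_, h, extendZero_coe g⟩

theorem convex_holFuns : Convex ℝ HolFuns := by
  rintro f ⟨F, hF, hFf⟩ g ⟨G, hG, hGg⟩ a b _ _ _
  exact ⟨fun z => a * F z + b * G z, (hF.const_mul _).add (hG.const_mul _),
    fun z => by simp [hFf, hGg]⟩

theorem isClosed_holFuns : IsClosed HolFuns := by
  refine isClosed_of_closure_subset fun g hg => ?_
  obtain ⟨u, hu, hlim⟩ := mem_closure_iff_seq_limit.1 hg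
  rw [ContinuousMap.tendsto_iff_tendstoLocallyUniformly] at hlim
  have h : TendstoLocallyUniformlyOn (fun n => extendZero (u n)) (extendZero g) Filter.atTop
      PuncturedPlane := by
    rw [tendstoLocallyUniformlyOn_iff_tendstoLocallyUniformly_comp_coe]
    convert hlim using 1
    · ext n z
      exact extendZero_coe _ z
    · ext z
      exact extendZero_coe _ z
  exact mem_holFuns_iff.2 (h.differentiableOn
    (.of_forall fun n => mem_holFuns_iff.1 (hu n)) isOpen_puncturedPlane)

/-- Near `z` the imaginary part of `g w - g z` lies in `(-π, π)`, so `g` is there a constant plus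
the principal logarithm of a differentiable quotient. -/
theorem differentiableAt_of_exp {g : ℂ → ℂ} {z : ℂ} (hg : ContinuousAt g z)
    (h : DifferentiableAt ℂ (fun w => Complex.exp (g w)) z) : DifferentiableAt ℂ g z := by
  have hd : DifferentiableAt ℂ
      (fun w => g z + Complex.log (Complex.exp (g w) / Complex.exp (g z))) z := by
    refine (differentiableAt_const _).add ((h.div_const _).clog ?_)
    rw [div_self (Complex.exp_ne_zero _)]
    exact Complex.one_mem_slitPlane
  refine hd.congr_of_eventuallyEq ?_
  have him : Filter.Tendsto (fun w => (g w - g z).im) (𝓝 z) (𝓝 0) := by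
    have : ContinuousAt (fun w => (g w - g z).im) z :=
      Complex.continuous_im.continuousAt.comp (hg.sub continuousAt_const)
    simpa [ContinuousAt] using this
  filter_upwards [him.eventually (Ioo_mem_nhds (neg_lt_zero.2 Real.pi_pos) Real.pi_pos)]
    with w hw
  rw [← Complex.exp_sub, Complex.log_exp hw.1 hw.2.le, add_sub_cancel]

theorem mem_holFuns_of_exp {g : C(PuncturedPlane, ℂ)} {F : ℂ → ℂ}
    (hF : DifferentiableOn ℂ F PuncturedPlane)
    (h : ∀ z : PuncturedPlane, F z = Complex.exp (g z)) : g ∈ HolFuns := by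
  refine mem_holFuns_iff.2 fun z hz => DifferentiableAt.differentiableWithinAt ?_
  have hn := isOpen_puncturedPlane.mem_nhds hz
  refine differentiableAt_of_exp ?_ ((hF.differentiableAt hn).congr_of_eventuallyEq ?_)
  · refine ContinuousOn.continuousAt ?_ hn
    rw [continuousOn_iff_continuous_domRestrict]
    convert g.continuous using 1
    ext w
    exact extendZero_coe g w
  · filter_upwards [hn] with w hw
    rw [extendZero_coe g ⟨w, hw⟩, h ⟨w, hw⟩]

/-! ### The logarithm of a map of winding numbers zero -/

theorem mem_slitDomain_or {z : ℂ} (hz : z ∈ PuncturedPlane) :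
    z ∈ slitDomain 1 ∨ z ∈ slitDomain (-1) := by
  by_contra! h
  obtain ⟨h1, h2⟩ := h
  simp only [slitDomain, Set.mem_ofPred_eq, not_forall, Units.val_one, Units.val_neg] at h1 h2
  obtain ⟨n, hn, h1⟩ := h1
  obtain ⟨_, _, h2⟩ := h2
  exact hz n (Complex.ext (by simpa using hn) (by simp; linarith))

theorem slitLog_eq_slitLog {f : ContMaps} (hf : ∀ n, winding n f = 0) {z : ℂ}
    (h1 : z ∈ slitDomain 1) (h2 : z ∈ slitDomain (-1)) :
    slitLog 1 (f, ⟨z, h1⟩) = slitLog (-1) (f, ⟨z, h2⟩) := by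
  obtain ⟨j, hj⟩ := exists_mem_strip (z := z) fun n hn => by
    have h3 := h1 n hn
    have h4 := h2 n hn
    rw [Units.val_one] at h3
    rw [Units.val_neg, Units.val_one] at h4
    linarith
  have h := slitLog_sub_slitLog j f ⟨z, hj⟩
  rw [logJump_eq_zero hf, sub_eq_zero] at h
  exact h

/-- A continuous family of maps of winding numbers zero has a continuous family of logarithms. -/
theorem exists_log_of_winding_eq_zero {T : Type*} [TopologicalSpace T] (q : C(T, ContMaps))
    (hq : ∀ t n, winding n (q t) = 0) :
    ∃ L : C(T, C(PuncturedPlane, ℂ)), ∀ t z, (q t z : ℂ) = q t 0 * Complex.exp (L t z) := by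
  classical
  -- The slit domains cover the punctured plane and overlap in the strips, where vanishing winding
  -- numbers make the two logarithms agree.
  let Λ : T × PuncturedPlane → ℂ := fun p =>
    if h : (p.2 : ℂ) ∈ slitDomain 1 then slitLog 1 (q p.1, ⟨p.2, h⟩)
    else slitLog (-1) (q p.1, ⟨p.2, (mem_slitDomain_or p.2.2).resolve_left h⟩)
  have h1 : ∀ p (h : (p.2 : ℂ) ∈ slitDomain 1), Λ p = slitLog 1 (q p.1, ⟨p.2, h⟩) :=
    fun p h => dif_pos h
  have h2 : ∀ p (h : (p.2 : ℂ) ∈ slitDomain (-1)), Λ p = slitLog (-1) (q p.1, ⟨p.2, h⟩) := by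
    intro p h
    by_cases h' : (p.2 : ℂ) ∈ slitDomain 1
    · rw [h1 p h', slitLog_eq_slitLog (hq p.1) h' h]
    · exact dif_neg h'
  have hcont : ∀ s : ℝˣ,
      (∀ p (h : (p.2 : ℂ) ∈ slitDomain s), Λ p = slitLog s (q p.1, ⟨p.2, h⟩)) →
      ∀ p : T × PuncturedPlane, (p.2 : ℂ) ∈ slitDomain s → ContinuousAt Λ p := by
    intro s hs p hp
    have hopen : IsOpen {p : T × PuncturedPlane | (p.2 : ℂ) ∈ slitDomain s} :=
      (isOpen_slitDomain s).preimage (continuous_subtype_val.comp continuous_snd)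
    refine ContinuousOn.continuousAt ?_ (hopen.mem_nhds hp)
    rw [continuousOn_iff_continuous_domRestrict]
    have : Continuous fun p : {p : T × PuncturedPlane | (p.2 : ℂ) ∈ slitDomain s} =>
        slitLog s (q p.1.1, ⟨p.1.2, p.2⟩) := by
      refine (continuous_slitLog s).comp (Continuous.prodMk (by fun_prop) ?_)
      exact Continuous.subtype_mk (by fun_prop) _
    convert this using 1
    ext p
    exact hs p.1 p.2
  have hΛ : Continuous Λ := continuous_iff_continuousAt.2 fun p =>
    (mem_slitDomain_or p.2.2).elim (hcont 1 h1 p) (hcont (-1) h2 p)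
  refine ⟨ContinuousMap.curry ⟨Λ, hΛ⟩, fun t z => ?_⟩
  have h0 := (q t).apply_ne_zero 0
  change _ = _ * Complex.exp (Λ (t, z))
  rcases mem_slitDomain_or z.2 with h | h
  · rw [h1 (t, z) h, exp_slitLog, mul_div_cancel₀ _ h0]
    rfl
  · rw [h2 (t, z) h, exp_slitLog, mul_div_cancel₀ _ h0]
    rfl

/-! ### The deformation -/

/-- The sequence of winding numbers. -/
noncomputable def windings : C(ContMaps, ℕ+ → ℤ) :=
  ⟨fun f n => winding n f, continuous_pi continuous_winding⟩

/-- The quotient of a map by the Weierstrass product with the same winding numbers. -/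
noncomputable def reduced : C(ContMaps, ContMaps) :=
  ContinuousMap.curry
    ⟨fun p => ⟨p.1 p.2 / weierstrassProd (windings p.1) p.2,
      div_ne_zero (p.1.apply_ne_zero _) (weierstrassProd_ne_zero _ p.2.2)⟩,
      Continuous.subtype_mk (Continuous.div (by fun_prop)
        (continuous_weierstrassProd.comp
          (f := fun p : ContMaps × PuncturedPlane => (windings p.1, p.2)) (by fun_prop))
        fun p => weierstrassProd_ne_zero _ p.2.2) _⟩

theorem eq_reduced_mul (f : ContMaps) (z : PuncturedPlane) :
    (f z : ℂ) = reduced f z * divisorMap (windings f) z :=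
  (div_mul_cancel₀ _ (weierstrassProd_ne_zero _ z.2)).symm

theorem winding_reduced (f : ContMaps) (n : ℕ+) : winding n (reduced f) = 0 := by
  have h := winding_of_mul (eq_reduced_mul f) n
  rw [winding_divisorMap] at h
  exact add_eq_right.1 h.symm

theorem isDeformationRetract_holMaps : IsDeformationRetract HolMaps := by
  obtain ⟨L, hL⟩ := exists_log_of_winding_eq_zero reduced winding_reduced
  obtain ⟨r, hr, hr'⟩ := ContinuousMap.exists_retraction_of_isClosed_convex isClosed_holFuns
    convex_holFuns ⟨0, 0, differentiableOn_const 0, fun _ => rfl⟩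
  let H : C(I × ContMaps, ContMaps) := ContinuousMap.curry
    ⟨fun p => ⟨p.1.2 p.2 * Complex.exp ((p.1.1 : ℝ) * (r (L p.1.2) p.2 - L p.1.2 p.2)),
      mul_ne_zero (p.1.2.apply_ne_zero _) (Complex.exp_ne_zero _)⟩,
      Continuous.subtype_mk (by fun_prop) _⟩
  have hH : ∀ t f z, (H (t, f) z : ℂ) =
      f z * Complex.exp ((t : ℝ) * (r (L f) z - L f z)) := fun _ _ _ => rfl
  have hext : ∀ f g : ContMaps, (∀ z, (f z : ℂ) = g z) → f = g := fun f g h =>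
    ContinuousMap.ext fun z => Subtype.ext (h z)
  -- At time 1 the factor `exp (L f)` cancels, leaving a constant times the Weierstrass product
  -- times `exp (r (L f))`.
  have hH1 : ∀ f, H (1, f) ∈ HolMaps := by
    intro f
    obtain ⟨R, hR, hR'⟩ := hr (L f)
    refine ⟨fun z => reduced f 0 * weierstrassProd (windings f) z * Complex.exp (R z),
      ((differentiableOn_weierstrassProd _).const_mul _).mul hR.cexp, fun z => ?_⟩
    dsimp only
    rw [hH, eq_reduced_mul f z, hL f z, hR', coe_divisorMap, Set.Icc.coe_one, Complex.ofReal_one,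
      one_mul, Complex.exp_sub]
    field_simp
  have hHol : ∀ f ∈ HolMaps, ∀ t, H (t, f) = f := by
    rintro f ⟨F, hF, hFf⟩ t
    have hLf : L f ∈ HolFuns := by
      refine mem_holFuns_of_exp
        (F := fun z => (reduced f 0 : ℂ)⁻¹ * (F z / weierstrassProd (windings f) z)) ?_ fun z => ?_
      · exact (hF.div (differentiableOn_weierstrassProd _)
          fun z hz => weierstrassProd_ne_zero _ hz).const_mul _
      · rw [hFf, eq_reduced_mul f z, hL f z, coe_divisorMap]
        have h0 := (reduced f).apply_ne_zero 0
        have h1 := weierstrassProd_ne_zero (windings f) z.2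
        field_simp
    refine hext _ _ fun z => ?_
    rw [hH, hr' _ hLf, sub_self, mul_zero, Complex.exp_zero, mul_one]
  refine ⟨⟨fun f => ⟨H (1, f), hH1 f⟩, Continuous.subtype_mk (by fun_prop) _⟩, ⟨?_⟩⟩
  exact
    { toContinuousMap := H
      map_zero_left := fun f => hext _ _ fun z => by simp [hH]
      map_one_left := fun f => rfl
      prop' := fun t f hf => hHol f hf t }

theorem mainTheorem7 :
    (¬ SemilocallyContractible ContMaps ∧ ¬ SemilocallyContractible HolMaps) ∧
    (¬ HasCWHomotopyType ContMaps ∧ ¬ HasCWHomotopyType HolMaps) ∧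
    (¬ IsMCofibrant ContMaps ∧ ¬ IsMCofibrant HolMaps) ∧
    (∃ s : C(ℕ+ → ℤ, HolMaps), ∀ (ν : ℕ+ → ℤ) (n : ℕ+), HasWindingNumber (s ν) n (ν n)) ∧
    IsDeformationRetract HolMaps := by
  let s : C(ℕ+ → ℤ, HolMaps) :=
    ⟨fun ν => ⟨divisorMap ν, divisorMap_mem_holMaps ν⟩, divisorMap.continuous.subtype_mk _⟩
  have hC : ¬ OpenPathComponents ContMaps :=
    not_openPathComponents divisorMap (.id _) winding_divisorMap
  have hO : ¬ OpenPathComponents HolMaps :=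
    not_openPathComponents s ⟨Subtype.val, continuous_subtype_val⟩ winding_divisorMap
  refine ⟨⟨fun h => hC h.openPathComponents, fun h => hO h.openPathComponents⟩,
    ⟨fun h => hC h.openPathComponents, fun h => hO h.openPathComponents⟩,
    ⟨fun h => hC h.openPathComponents, fun h => hO h.openPathComponents⟩,
    ⟨s, fun ν n => ?_⟩, isDeformationRetract_holMaps⟩
  have h := hasWindingNumber_winding n (divisorMap ν)
  rwa [winding_divisorMap] at h
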